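/- Conventions. A structure is *$\omega$-homogeneous* if every isomorphism between two of its finitely generated substructures extends to an automorphism of the structure. Graphs are undirected and simple; for $n\in\mathbb N$, a graph is *$K_n$-free* if it does not contain the complete graph on $n$ vertices. A *hypergraph* in a finite relational signature $L$ is an $L$-structure in which, for every relation symbol $R\in L$ of arity $l$, every tuple $(h_0,\dots,h_{l-1})\in R$ has pairwise distinct entries and $(h_{\sigma(0)},\dots,h_{\sigma(l-1)})\in R$ for every permutation $\sigma$ of $\{0,\dots,l-1\}$. A hypergraph is *irreducible* if it has at least two elements and any two distinct elements occur together in some tuple of some relation. If $\mathcal A$ is a class of finite irreducible hypergraphs in signature $L$, a hypergraph in signature $L$ is *$\mathcal A$-free* if no member of $\mathcal A$ embeds into it (as an induced substructure). Theorem. Let $\kappa$ be any infinite cardinal. Let $A$ be a structure of cardinality $\kappa$ of one of the following types: a graph; a $K_n$-free graph for a given $n\in\mathbb N$; a hypergraph in a given finite relational signature; an $\mathcal A$-free hypergraph for a given class $\mathcal A$ of finite irreducible hypergraphs in a given finite relational signature; a poset. Let $<$ be an arbitrary linear order on $A$, which in the poset case is assumed to extend the partial order. Then there exists a structure $A'$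 of the same type (with the same $n$, signature and $\mathcal A$, respectively) and of cardinality $\kappa$, together with a linear order $<'$ on $A'$, such that $(A,<)$ embeds into $(A',<')$, both $A'$ and $(A',<')$ are $\omega$-homogeneous, and, in the poset case, $<'$ extends the partial order of $A'$. -/

import Mathlib

universe u v v' w

open Cardinal

namespace OrderedHomogeneous

open FirstOrder.Language FirstOrder.Language.Structure

/-- The expansion `(A, <)` of an `L`-structure `S` on `A` by a linear order `r` on `A`: a structure
in the disjoint union of `L` and the language with one binary symbol, interpreted by `≤` of `r`. -/
abbrev orderedStructure {L : FirstOrder.Language.{v, v'}} {A : Type u} (S : L.Structure A)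
    (r : LinearOrder A) : (L.sum FirstOrder.Language.order).Structure A :=
  @FirstOrder.Language.sumStructure L FirstOrder.Language.order A S
    (@FirstOrder.Language.orderStructure A r.toLE)

/-- The poset `P` as a structure in the language with one binary symbol. -/
abbrev posetStructure {A : Type u} (P : PartialOrder A) : FirstOrder.Language.order.Structure A :=
  @FirstOrder.Language.orderStructure A P.toLE

/-- The linear order `r` extends the partial order `P`. -/
def Extends {A : Type u} (r : LinearOrder A) (P : PartialOrder A) : Prop :=
  ∀ a b : A, P.le a b → r.le a b

/-- An `L`-structure (for a relational language `L`) is a hypergraph if every tuple in one of its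
relations has pairwise distinct entries and each relation is closed under permuting entries. -/
def IsHypergraph {L : FirstOrder.Language.{v, v'}} {A : Type u} (S : L.Structure A) : Prop :=
  ∀ (l : ℕ) (R : L.Relations l) (h : Fin l → A), S.RelMap R h →
    Function.Injective h ∧ ∀ σ : Equiv.Perm (Fin l), S.RelMap R (h ∘ σ)

/-- A hypergraph is irreducible if it has at least two elements and any two distinct elements lie
in a common hyperedge. -/
def IsIrreducibleHypergraph {L : FirstOrder.Language.{v, v'}} {A : Type u} (S : L.Structure A) : Prop :=
  Nontrivial A ∧ ∀ x y : A, x ≠ y →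
    ∃ (l : ℕ) (R : L.Relations l) (h : Fin l → A),
      S.RelMap R h ∧ x ∈ Set.range h ∧ y ∈ Set.range h

/-- No member of the class `𝒜` embeds (as an induced substructure) into the given structure. -/
def IsFreeOf {L : FirstOrder.Language.{v, v'}} (𝒜 : Set (CategoryTheory.Bundled.{w} L.Structure))
    {A : Type u} (S : L.Structure A) : Prop :=
  ∀ H ∈ 𝒜, IsEmpty (@FirstOrder.Language.Embedding L H A H.str S)

/-- `(A, r)` embeds into `(A', r')`, and both the reduct `A'` and the ordered structure `(A', r')`
are `ω`-homogeneous: isomorphisms between finitely generated substructures extend to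
automorphisms. -/
structure IsHomogeneousOrderedExtension {L : FirstOrder.Language.{v, v'}} {A A' : Type u}
    (S : L.Structure A) (r : LinearOrder A) (S' : L.Structure A') (r' : LinearOrder A') :
    Prop where
  embeds : Nonempty (@FirstOrder.Language.Embedding (L.sum FirstOrder.Language.order) A A'
    (orderedStructure S r) (orderedStructure S' r'))
  homogeneous : @FirstOrder.Language.IsUltrahomogeneous L A' S'
  homogeneous_ordered :
    @FirstOrder.Language.IsUltrahomogeneous (L.sum FirstOrder.Language.order) A'
      (orderedStructure S' r')

end OrderedHomogeneous

open OrderedHomogeneous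

/-! The heart is a one-step extension. Given an ordered structure `A` of the type considered, take
every partial self-embedding `f` of `A`, both those that respect the linear order and those that
respect only the relations. For each `f` attach a fresh copy of `A` to `A`, identifying a point `a`
of the domain of `f` with `f a`. In the resulting `Glue`, each `f` is the restriction of an
embedding of `A`, namely the map onto the `f`-th copy. Serving both kinds of `f` at once is what
makes the final structure homogeneous with and without its order.

The relations on the gluing are those of an amalgam. For hypergraphs it is the free one: an
irreducible hypergraph inside it lies in `A` or in a single copy, so nothing forbidden arises. For
posets it is the amalgam in which points of different pieces are compared through an element of `A`.
The linear order comes from cuts: a new point `a` of the `f`-th copy is placed just above the images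
of those domain elements that must precede it. If `f` respects the order, these are all domain
elements below `a`; otherwise they are only those that the partial order forces (none for
hypergraphs).

Iterating the step countably often and taking the union gives a structure in the class that is
homogeneous in both senses, by back-and-forth (`IsExtensible.exists_homogeneous`). It may be far
larger than `κ`. A Löwenheim–Skolem argument (`exists_homogeneous_subset`) then closes the image of
`A` under `κ` chosen automorphisms and their inverses. Since the class is hereditary, this subset is
the required structure (`IsExtensible.exists_extension`). -/

namespace OrderedHomogeneous

open FirstOrder.Language FirstOrder.Language.Structure

/-! ### Partial isomorphisms, back-and-forth and the reduction of cardinality. -/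

section Framework

variable (L : FirstOrder.Language.{v, v'})

/-- `e` is injective and preserves and reflects the relations of `L`; if `b = true`, it moreover
preserves the linear order. -/
structure IsEmb (b : Bool) {A B : Type*} [L.Structure A] [LinearOrder A] [L.Structure B]
    [LinearOrder B] (e : A → B) : Prop where
  inj : Function.Injective e
  rel : ∀ (l : ℕ) (R : L.Relations l) (h : Fin l → A), RelMap R (e ∘ h) ↔ RelMap R h
  mono : b = true → StrictMono e

/-- `φ` restricts to an embedding (in the sense of `IsEmb`) on the set `s`. -/
structure IsPartialEmb (b : Bool) {A : Type*} [L.Structure A] [LinearOrder A] (s : Set A)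
    (φ : A → A) : Prop where
  inj : Set.InjOn φ s
  rel : ∀ (l : ℕ) (R : L.Relations l) (h : Fin l → A), (∀ i, h i ∈ s) →
    (RelMap R (φ ∘ h) ↔ RelMap R h)
  mono : b = true → StrictMonoOn φ s

/-- `Γ` is the graph of a partial isomorphism, order preserving if `b = true`. -/
structure IsPartialIso (b : Bool) {M : Type*} [L.Structure M] [LinearOrder M]
    (Γ : Set (M × M)) : Prop where
  inj : ∀ p ∈ Γ, ∀ q ∈ Γ, (p.1 = q.1 ↔ p.2 = q.2)
  rel : ∀ (l : ℕ) (R : L.Relations l) (h h' : Fin l → M), (∀ i, (h i, h' i) ∈ Γ) →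
    (RelMap R h ↔ RelMap R h')
  lt_iff : b = true → ∀ p ∈ Γ, ∀ q ∈ Γ, (p.1 < q.1 ↔ p.2 < q.2)

/-- Every finite partial isomorphism extends to an automorphism (preserving the linear order if
`b = true`). -/
def IsHomogeneous (b : Bool) (M : Type*) [L.Structure M] [LinearOrder M] : Prop :=
  ∀ Γ : Set (M × M), Γ.Finite → IsPartialIso L b Γ →
    ∃ g : M ≃ M, IsEmb L b g ∧ ∀ p ∈ Γ, g p.1 = p.2

variable {L}

theorem IsEmb.comp {b : Bool} {A B C : Type*} [L.Structure A] [LinearOrder A] [L.Structure B]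
    [LinearOrder B] [L.Structure C] [LinearOrder C] {g : B → C} {f : A → B}
    (hg : IsEmb L b g) (hf : IsEmb L b f) : IsEmb L b (g ∘ f) where
  inj := hg.inj.comp hf.inj
  rel l R h := by rw [Function.comp_assoc, hg.rel, hf.rel]
  mono hb := (hg.mono hb).comp (hf.mono hb)

theorem IsEmb.of_true {A B : Type*} [L.Structure A] [LinearOrder A] [L.Structure B]
    [LinearOrder B] {f : A → B} (hf : IsEmb L true f) (b : Bool) : IsEmb L b f :=
  ⟨hf.inj, hf.rel, fun _ => hf.mono rfl⟩

/-- Two embeddings with the same source give a partial isomorphism between their ranges. -/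
theorem isPartialIso_range {b : Bool} {A M : Type*} [L.Structure A] [LinearOrder A]
    [L.Structure M] [LinearOrder M] {f g : A → M} (hf : IsEmb L b f) (hg : IsEmb L b g) :
    IsPartialIso L b (Set.range fun x => (f x, g x)) where
  inj := by
    rintro _ ⟨x, rfl⟩ _ ⟨y, rfl⟩
    exact hf.inj.eq_iff.trans hg.inj.eq_iff.symm
  rel l R h h' hh := by
    choose x hx using hh
    have h1 : h = f ∘ x := funext fun i => (congrArg Prod.fst (hx i)).symm
    have h2 : h' = g ∘ x := funext fun i => (congrArg Prod.snd (hx i)).symm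
    rw [h1, h2, hf.rel, hg.rel]
  lt_iff hb := by
    rintro _ ⟨x, rfl⟩ _ ⟨y, rfl⟩
    exact (hf.mono hb).lt_iff_lt.trans (hg.mono hb).lt_iff_lt.symm

section PartialIso

variable {b : Bool} {M : Type*} [L.Structure M] [LinearOrder M]

theorem IsPartialIso.swap {Γ : Set (M × M)} (h : IsPartialIso L b Γ) :
    IsPartialIso L b (Prod.swap ⁻¹' Γ) where
  inj _ hp _ hq := (h.inj _ hp _ hq).symm
  rel l R x y hxy := (h.rel l R y x hxy).symm
  lt_iff hb _ hp _ hq := (h.lt_iff hb _ hp _ hq).symm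

/-- Each condition involves finitely many pairs, which all lie in one stage of the chain. -/
theorem IsPartialIso.iUnion {Γ : ℕ → Set (M × M)} (hm : Monotone Γ)
    (h : ∀ n, IsPartialIso L b (Γ n)) : IsPartialIso L b (⋃ n, Γ n) where
  inj p hp q hq := by
    obtain ⟨m, hp⟩ := Set.mem_iUnion.1 hp
    obtain ⟨n, hq⟩ := Set.mem_iUnion.1 hq
    exact (h (max m n)).inj _ (hm (le_max_left m n) hp) _ (hm (le_max_right m n) hq)
  rel l R x y hxy := by
    choose n hn using fun i => Set.mem_iUnion.1 (hxy i)
    obtain ⟨N, hN⟩ := (Set.finite_range n).bddAbove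
    exact (h N).rel l R x y fun i => hm (hN ⟨i, rfl⟩) (hn i)
  lt_iff hb p hp q hq := by
    obtain ⟨m, hp⟩ := Set.mem_iUnion.1 hp
    obtain ⟨n, hq⟩ := Set.mem_iUnion.1 hq
    exact (h (max m n)).lt_iff hb _ (hm (le_max_left m n) hp) _ (hm (le_max_right m n) hq)

/-- A partial isomorphism with full domain and range is an automorphism. -/
theorem IsPartialIso.exists_equiv {Γ : Set (M × M)} (h : IsPartialIso L b Γ)
    (hd : ∀ x, ∃ y, (x, y) ∈ Γ) (hr : ∀ y, ∃ x, (x, y) ∈ Γ) :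
    ∃ g : M ≃ M, IsEmb L b g ∧ ∀ p ∈ Γ, g p.1 = p.2 := by
  choose f hf using hd
  have hfi : Function.Injective f := fun x y hxy => (h.inj _ (hf x) _ (hf y)).2 hxy
  have hfu : ∀ p ∈ Γ, f p.1 = p.2 := fun p hp => (h.inj _ (hf p.1) _ hp).1 rfl
  have hfs : Function.Surjective f := fun y => by
    obtain ⟨x, hx⟩ := hr y
    exact ⟨x, hfu _ hx⟩
  exact ⟨Equiv.ofBijective f ⟨hfi, hfs⟩, ⟨hfi, fun l R x => (h.rel l R _ _ fun i => hf (x i)).symm,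
    fun hb x y hxy => (h.lt_iff hb _ (hf x) _ (hf y)).1 hxy⟩, hfu⟩

/-- If `M` is the union of an increasing chain of sets such that each partial isomorphism within
a member of the chain extends to one within the next member which is defined on the whole given
member, then `M` is homogeneous. -/
theorem isHomogeneous_of_chain (N : ℕ → Set M) (hN : Monotone N) (hU : ∀ x, ∃ n, x ∈ N n)
    (hext : ∀ n, ∀ Γ : Set (M × M), Γ ⊆ N n ×ˢ N n → IsPartialIso L b Γ →
      ∃ Γ' : Set (M × M), Γ ⊆ Γ' ∧ Γ' ⊆ N (n + 1) ×ˢ N (n + 1) ∧ IsPartialIso L b Γ' ∧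
        ∀ x ∈ N n, ∃ y, (x, y) ∈ Γ') : IsHomogeneous L b M := by
  intro Γ hfin hΓ
  -- Going forth moves from `N n` to `N (n + 1)`, and going back, by extending the inverse, from
  -- there to `N (n + 2)`; hence the index advances by two.
  have step : ∀ n, ∀ Γ : Set (M × M), (Γ ⊆ N n ×ˢ N n ∧ IsPartialIso L b Γ) →
      ∃ Γ' : Set (M × M), Γ ⊆ Γ' ∧ (Γ' ⊆ N (n + 2) ×ˢ N (n + 2) ∧ IsPartialIso L b Γ') ∧
        (∀ x ∈ N n, ∃ y, (x, y) ∈ Γ') ∧ ∀ y ∈ N n, ∃ x, (x, y) ∈ Γ' := by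
    rintro n Γ ⟨h1, h2⟩
    obtain ⟨Δ, a1, a2, a3, a4⟩ := hext n Γ h1 h2
    obtain ⟨Δ', b1, b2, b3, b4⟩ := hext (n + 1) (Prod.swap ⁻¹' Δ)
      (fun p hp => ⟨(a2 hp).2, (a2 hp).1⟩) a3.swap
    refine ⟨Prod.swap ⁻¹' Δ', fun p hp => b1 (a1 hp), ⟨fun p hp => ⟨(b2 hp).2, (b2 hp).1⟩,
      b3.swap⟩, fun x hx => ?_, fun y hy => b4 y (hN n.le_succ hy)⟩
    obtain ⟨y, hy⟩ := a4 x hx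
    exact ⟨y, b1 hy⟩
  obtain ⟨n₀, hn₀⟩ : ∃ n, Γ ⊆ N n ×ˢ N n := by
    choose k hk using hU
    obtain ⟨m, hm⟩ := (hfin.image fun p => max (k p.1) (k p.2)).bddAbove
    refine ⟨m, fun p hp => ⟨hN ?_ (hk p.1), hN ?_ (hk p.2)⟩⟩
    · exact (le_max_left _ _).trans (hm ⟨p, hp, rfl⟩)
    · exact (le_max_right _ _).trans (hm ⟨p, hp, rfl⟩)
  choose! next hsub hnext hdom hran using step
  let s : ℕ → Set (M × M) := fun k => Nat.rec Γ (fun k Δ => next (n₀ + 2 * k) Δ) k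
  have hs : ∀ k, s k ⊆ N (n₀ + 2 * k) ×ˢ N (n₀ + 2 * k) ∧ IsPartialIso L b (s k) := by
    intro k
    induction k with
    | zero => exact ⟨hn₀, hΓ⟩
    | succ k ih => exact hnext _ _ ih
  have hmono : Monotone s := monotone_nat_of_le_succ fun k => hsub _ _ (hs k)
  have hbig : ∀ x, ∃ k, x ∈ N (n₀ + 2 * k) := fun x => by
    obtain ⟨n, hn⟩ := hU x
    exact ⟨n, hN (by omega) hn⟩
  obtain ⟨g, hg, hg'⟩ := (IsPartialIso.iUnion hmono fun k => (hs k).2).exists_equiv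
    (fun x => by
      obtain ⟨k, hk⟩ := hbig x
      obtain ⟨y, hy⟩ := hdom _ _ (hs k) x hk
      exact ⟨y, Set.mem_iUnion.2 ⟨k + 1, hy⟩⟩)
    (fun y => by
      obtain ⟨k, hk⟩ := hbig y
      obtain ⟨x, hx⟩ := hran _ _ (hs k) y hk
      exact ⟨x, Set.mem_iUnion.2 ⟨k + 1, hx⟩⟩)
  exact ⟨g, hg, fun p hp => hg' p (Set.mem_iUnion.2 ⟨0, hp⟩)⟩

end PartialIso

theorem mk_finset_prod_le {α : Type u} {κ : Cardinal.{u}} (hκ : ℵ₀ ≤ κ) (h : #α ≤ κ) :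
    #(Finset (α × α)) ≤ κ := by
  rcases finite_or_infinite (α × α) with hfin | hinf
  · exact (lt_aleph0_of_finite (Finset (α × α))).le.trans hκ
  · rw [mk_finset_of_infinite, mk_prod, lift_id]
    exact mul_le_of_le hκ h h

/-- In a homogeneous structure, every set is contained in a set of at most the same infinite
cardinality all of whose finite partial isomorphisms extend to automorphisms preserving that set. -/
theorem exists_homogeneous_subset {M : Type u} [L.Structure M] [LinearOrder M]
    (hM : ∀ b, IsHomogeneous L b M) {κ : Cardinal.{u}} (hκ : ℵ₀ ≤ κ) (s : Set M) (hs : #s ≤ κ) :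
    ∃ t : Set M, s ⊆ t ∧ #t ≤ κ ∧ ∀ b, ∀ Γ : Set (M × M), Γ.Finite → Γ ⊆ t ×ˢ t →
      IsPartialIso L b Γ →
      ∃ g : M ≃ M, IsEmb L b g ∧ (∀ p ∈ Γ, g p.1 = p.2) ∧ ∀ x, g x ∈ t ↔ x ∈ t := by
  classical
  -- One automorphism is fixed for each finite `Γ`, with the identity as a dummy value when `Γ` is
  -- not a partial isomorphism.
  have key : ∀ (b : Bool) (Γ : Finset (M × M)), ∃ g : M ≃ M, IsPartialIso L b (Γ : Set (M × M)) →
      IsEmb L b g ∧ ∀ p ∈ Γ, g p.1 = p.2 := fun b Γ => by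
    by_cases h : IsPartialIso L b (Γ : Set (M × M))
    · obtain ⟨g, hg⟩ := hM b Γ Γ.finite_toSet h
      exact ⟨g, fun _ => hg⟩
    · exact ⟨Equiv.refl M, fun h' => absurd h' h⟩
  choose g hg using key
  -- One round of closure: the left summand keeps `t`, the right one adds the images of its points
  -- under the automorphisms chosen for finite `Γ` within `t`. The first Boolean says whether the
  -- order is respected, the second chooses between the automorphism and its inverse.
  let F : (t : Set M) → t ⊕ (Bool × Bool × Finset (t × t) × t) → M := fun t =>
    Sum.elim Subtype.val fun q =>
      let h := g q.1 (q.2.2.1.map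
        ((Function.Embedding.subtype _).prodMap (Function.Embedding.subtype _)))
      if q.2.1 then h q.2.2.2 else h.symm q.2.2.2
  let T : ℕ → Set M := fun n => Nat.rec s (fun _ t => Set.range (F t)) n
  have hTsucc : ∀ n, T n ⊆ T (n + 1) := fun n x hx => ⟨Sum.inl ⟨x, hx⟩, rfl⟩
  have hTm : Monotone T := monotone_nat_of_le_succ hTsucc
  have hTc : ∀ n : ℕ, #↥(T n) ≤ κ := by
    intro n
    induction n with
    | zero => exact hs
    | succ n ih =>
      refine mk_range_le.trans ?_
      have hfin := mk_finset_prod_le hκ ih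
      have hB : ((2 : ℕ) : Cardinal.{u}) ≤ κ := (natCast_lt_aleph0 (n := 2)).le.trans hκ
      simp only [mk_sum, mk_prod, lift_id, mk_bool, lift_uzero, lift_ofNat]
      refine add_le_of_le hκ ih ?_
      have h2 := mul_le_of_le hκ hB (mul_le_of_le hκ hfin ih)
      exact mul_le_of_le hκ (by exact_mod_cast hB) (by simpa using h2)
  refine ⟨⋃ n, T n, Set.subset_iUnion T 0, ?_, ?_⟩
  · have h := mk_iUnion_le_lift T
    rw [lift_uzero, mk_nat, lift_aleph0] at h
    exact h.trans (mul_le_of_le hκ hκ (ciSup_le' fun n => by simpa using hTc n))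
  · intro b Γ hfin hΓ hp
    lift Γ to Finset (M × M) using hfin
    obtain ⟨n₀, hn₀⟩ : ∃ n, (Γ : Set (M × M)) ⊆ T n ×ˢ T n := by
      have h1 : ∀ p : Γ, ∃ n, p.1 ∈ T n ×ˢ T n := fun p => by
        obtain ⟨m, hm⟩ := Set.mem_iUnion.1 (hΓ p.2).1
        obtain ⟨n, hn⟩ := Set.mem_iUnion.1 (hΓ p.2).2
        exact ⟨max m n, hTm (le_max_left m n) hm, hTm (le_max_right m n) hn⟩
      choose k hk using h1
      obtain ⟨m, hm⟩ := (Set.finite_range k).bddAbove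
      exact ⟨m, fun p hp => ⟨hTm (hm ⟨⟨p, hp⟩, rfl⟩) (hk ⟨p, hp⟩).1,
        hTm (hm ⟨⟨p, hp⟩, rfl⟩) (hk ⟨p, hp⟩).2⟩⟩
    -- `Γ` is seen at every stage from `n₀` on, so its automorphism is applied to every point that
    -- enters later.
    have himg : ∀ n, n₀ ≤ n → ∃ Δ : Finset (↥(T n) × ↥(T n)),
        Δ.map ((Function.Embedding.subtype _).prodMap (Function.Embedding.subtype _)) = Γ := by
      intro n hn
      refine ⟨Γ.attach.image fun p => (⟨p.1.1, hTm hn (hn₀ p.2).1⟩, ⟨p.1.2, hTm hn (hn₀ p.2).2⟩), ?_⟩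
      ext p
      simp only [Finset.mem_map, Finset.mem_image, Finset.mem_attach, true_and]
      constructor
      · rintro ⟨_, ⟨q, rfl⟩, rfl⟩
        exact q.2
      · exact fun hp => ⟨_, ⟨⟨p, hp⟩, rfl⟩, rfl⟩
    have hstep : ∀ x, x ∈ ⋃ n, T n → g b Γ x ∈ ⋃ n, T n ∧ (g b Γ).symm x ∈ ⋃ n, T n := by
      intro x hx
      obtain ⟨m, hm⟩ := Set.mem_iUnion.1 hx
      obtain ⟨Δ, hΔ⟩ := himg (max m n₀) (le_max_right _ _)
      have hx' : x ∈ T (max m n₀) := hTm (le_max_left _ _) hm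
      constructor
      · refine Set.mem_iUnion.2 ⟨max m n₀ + 1, Sum.inr (b, true, Δ, ⟨x, hx'⟩), ?_⟩
        exact congrArg (fun Δ => g b Δ x) hΔ
      · refine Set.mem_iUnion.2 ⟨max m n₀ + 1, Sum.inr (b, false, Δ, ⟨x, hx'⟩), ?_⟩
        exact congrArg (fun Δ => (g b Δ).symm x) hΔ
    refine ⟨g b Γ, (hg b Γ hp).1, (hg b Γ hp).2, fun x => ⟨fun hx => ?_, fun hx => (hstep x hx).1⟩⟩
    simpa using (hstep _ hx).2

end Framework

/-! ### Extensible classes and their homogeneous members. -/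

section Extensible

/-- A class of linearly ordered `L`-structures which is hereditary, local (membership is determined
by substructures covering the finite subsets), and such that every member `A` has an extension `B` in
the class for which each partial self-embedding of `A` is restricted from an embedding `A → B`. -/
structure IsExtensible {L : FirstOrder.Language.{v, v'}}
    (K : ∀ A : Type u, L.Structure A → LinearOrder A → Prop) : Prop where
  hereditary : ∀ (A B : Type u) [SA : L.Structure A] [rA : LinearOrder A] [SB : L.Structure B]
    [rB : LinearOrder B] (e : A → B), IsEmb L true e → K B SB rB → K A SA rA
  local_finite : ∀ (D : Type u) [SD : L.Structure D] [rD : LinearOrder D],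
    (∀ s : Set D, s.Finite → ∃ (A : Type u) (SA : L.Structure A) (rA : LinearOrder A) (e : A → D),
      IsEmb L true e ∧ s ⊆ Set.range e ∧ K A SA rA) → K D SD rD
  extend : ∀ (A : Type u) [SA : L.Structure A] [rA : LinearOrder A], K A SA rA →
    ∃ (B : Type u) (SB : L.Structure B) (rB : LinearOrder B) (e : A → B),
      IsEmb L true e ∧ K B SB rB ∧ ∀ (b : Bool) (s : Set A) (φ : A → A), IsPartialEmb L b s φ →
        ∃ j : A → B, IsEmb L b j ∧ ∀ x ∈ s, j x = e (φ x)

variable {L : FirstOrder.Language.{v, v'}}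

/-- An order-preserving embedding as an embedding of the expansions by the linear orders. -/
def IsEmb.toEmbedding [L.IsRelational] {A B : Type u} [SA : L.Structure A] [rA : LinearOrder A]
    [SB : L.Structure B] [rB : LinearOrder B] {e : A → B} (he : IsEmb L true e) :
    @FirstOrder.Language.Embedding (L.sum FirstOrder.Language.order) A B (orderedStructure SA rA)
      (orderedStructure SB rB) :=
  letI := orderedStructure SA rA
  letI := orderedStructure SB rB
  { toFun := e
    inj' := he.inj
    map_fun' := fun {n} f => isEmptyElim f
    map_rel' := by
      rintro n (R | R) x
      · exact he.rel n R x
      · cases R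
        exact (he.mono rfl).le_iff_le }

/-- The union of a chain of linearly ordered structures. -/
theorem exists_chain_union [L.IsRelational] (X : ℕ → Type u) [∀ n, L.Structure (X n)]
    [∀ n, LinearOrder (X n)] (i : ∀ n, X n → X (n + 1)) (hi : ∀ n, IsEmb L true (i n)) :
    ∃ (D : Type u) (_ : L.Structure D) (_ : LinearOrder D) (e : ∀ n, X n → D),
      (∀ n, IsEmb L true (e n)) ∧ (∀ n x, e (n + 1) (i n x) = e n x) ∧
      ∀ s : Set D, s.Finite → ∃ n, s ⊆ Set.range (e n) := by
  -- With the order coded as a relation symbol, the direct limit of structures carries the order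
  -- along.
  let : ∀ n, (L.sum FirstOrder.Language.order).Structure (X n) :=
    fun n => orderedStructure inferInstance inferInstance
  let f := FirstOrder.Language.DirectedSystem.natLERec fun n => (hi n).toEmbedding
  let D := FirstOrder.Language.DirectLimit X f
  let e : ∀ n, FirstOrder.Language.Embedding (L.sum FirstOrder.Language.order) (X n) D := fun n =>
    FirstOrder.Language.DirectLimit.of _ ℕ X f n
  have hfin : ∀ {α : Type} [Finite α] (x : α → D), ∃ n, ∃ y : α → X n, x = e n ∘ y := by
    intro α _ x
    obtain ⟨n, y, hy⟩ := FirstOrder.Language.DirectLimit.exists_quotient_mk'_sigma_mk'_eq X f x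
    exact ⟨n, y, hy⟩
  let le : D → D → Prop := fun a b =>
    RelMap (L := L.sum FirstOrder.Language.order) (n := 2) (Sum.inr orderRel.le) ![a, b]
  have hle : ∀ n (a b : X n), le (e n a) (e n b) ↔ a ≤ b := by
    intro n a b
    have := (e n).map_rel (Sum.inr orderRel.le : (L.sum FirstOrder.Language.order).Relations 2)
      ![a, b]
    have h2 : e n ∘ ![a, b] = ![e n a, e n b] := by
      ext i; fin_cases i <;> rfl
    rw [h2] at this
    exact this
  have h3 : ∀ a b c : D, ∃ n, ∃ a' b' c' : X n, a = e n a' ∧ b = e n b' ∧ c = e n c' := by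
    intro a b c
    obtain ⟨n, y, hy⟩ := hfin ![a, b, c]
    exact ⟨n, y 0, y 1, y 2, congrFun hy 0, congrFun hy 1, congrFun hy 2⟩
  let SD : L.Structure D :=
    { funMap := fun {n} f => isEmptyElim f
      RelMap := fun R x => RelMap (L := L.sum FirstOrder.Language.order) (Sum.inl R) x }
  let rD : LinearOrder D :=
    { le := le
      le_refl := fun a => by
        obtain ⟨n, a, -, -, rfl, -, -⟩ := h3 a a a
        exact (hle n a a).2 le_rfl
      le_trans := fun a b c => by
        obtain ⟨n, a, b, c, rfl, rfl, rfl⟩ := h3 a b c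
        simp only [hle]
        exact le_trans
      le_antisymm := fun a b => by
        obtain ⟨n, a, b, -, rfl, rfl, -⟩ := h3 a b b
        simp only [hle]
        exact fun h h' => congrArg _ (le_antisymm h h')
      le_total := fun a b => by
        obtain ⟨n, a, b, -, rfl, rfl, -⟩ := h3 a b b
        simp only [hle]
        exact le_total a b
      toDecidableLE := Classical.decRel _ }
  refine ⟨D, SD, rD, fun n => e n, fun n => ⟨(e n).injective, fun l R h => ?_, fun _ => ?_⟩, ?_, ?_⟩
  · exact (e n).map_rel (Sum.inl R : (L.sum FirstOrder.Language.order).Relations l) h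
  · exact strictMono_of_le_iff_le fun a b => (hle n a b).symm
  · intro n x
    have := FirstOrder.Language.DirectLimit.of_f (f := f) (hij := n.le_succ) (x := x)
    refine Eq.trans (congrArg (e (n + 1)) ?_) this
    rw [FirstOrder.Language.DirectedSystem.coe_natLERec]
    exact (Nat.leRecOn_succ' x).symm
  · intro s hs
    have := hs.to_subtype
    obtain ⟨n, y, hy⟩ := FirstOrder.Language.DirectLimit.exists_quotient_mk'_sigma_mk'_eq X f
      (Subtype.val : s → D)
    exact ⟨n, fun x hx => ⟨y ⟨x, hx⟩, (congrFun hy ⟨x, hx⟩).symm⟩⟩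

/-- If partial self-embeddings of `A` are restricted from embeddings into `B ⊇ A`, and `B` embeds
into `M`, then partial isomorphisms of `M` within `A` extend to `A`. -/
theorem extend_partialIso {b : Bool} {A B M : Type*} [L.Structure A] [LinearOrder A]
    [L.Structure B] [LinearOrder B] [L.Structure M] [LinearOrder M] {i : A → B} {e : A → M}
    {e' : B → M} (he : IsEmb L true e) (he' : IsEmb L true e') (hi : ∀ x, e' (i x) = e x)
    (hext : ∀ (s : Set A) (φ : A → A), IsPartialEmb L b s φ →
        ∃ j : A → B, IsEmb L b j ∧ ∀ x ∈ s, j x = i (φ x))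
    {Γ : Set (M × M)} (hΓ : Γ ⊆ Set.range e ×ˢ Set.range e) (h : IsPartialIso L b Γ) :
    ∃ Γ' : Set (M × M), Γ ⊆ Γ' ∧ Γ' ⊆ Set.range e' ×ˢ Set.range e' ∧ IsPartialIso L b Γ' ∧
        ∀ x ∈ Set.range e, ∃ y, (x, y) ∈ Γ' := by
  -- The partial map is made total; its value off the domain of `Γ` is a dummy.
  have h1 : ∀ x : A, ∃ y : A, (∃ z, (e x, e z) ∈ Γ) → (e x, e y) ∈ Γ := fun x => by
    by_cases hx : ∃ z, (e x, e z) ∈ Γ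
    · exact ⟨hx.choose, fun _ => hx.choose_spec⟩
    · exact ⟨x, fun h => absurd h hx⟩
  choose φ hφ using h1
  obtain ⟨j, hj, hjφ⟩ := hext {x | ∃ z, (e x, e z) ∈ Γ} φ
    { inj := fun x hx y hy hxy =>
        he.inj ((h.inj _ (hφ x hx) _ (hφ y hy)).2 (congrArg e hxy))
      rel := fun l R x hx => by
        rw [← he.rel, ← he.rel]
        exact (h.rel l R _ _ fun k => hφ _ (hx k)).symm
      mono := fun hb x hx y hy hxy =>
        (he.mono rfl).lt_iff_lt.1
          ((h.lt_iff hb _ (hφ x hx) _ (hφ y hy)).1 ((he.mono rfl).lt_iff_lt.2 hxy)) }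
  refine ⟨Set.range fun x => (e x, e' (j x)), ?_, ?_,
    isPartialIso_range (he.of_true b) ((he'.of_true b).comp hj), ?_⟩
  · rintro ⟨p, q⟩ hp
    obtain ⟨⟨x, rfl⟩, ⟨y, rfl⟩⟩ := hΓ hp
    refine ⟨x, Prod.ext rfl ?_⟩
    change e' (j x) = e y
    rw [hjφ x ⟨y, hp⟩, hi]
    exact (h.inj _ (hφ x ⟨y, hp⟩) _ hp).1 rfl
  · rintro _ ⟨x, rfl⟩
    exact ⟨⟨i x, hi x⟩, ⟨j x, rfl⟩⟩
  · rintro _ ⟨x, rfl⟩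
    exact ⟨_, ⟨x, rfl⟩⟩

/-- Members of an extensible class embed into homogeneous members of the class. -/
theorem IsExtensible.exists_homogeneous [L.IsRelational]
    {K : ∀ A : Type u, L.Structure A → LinearOrder A → Prop} (hK : IsExtensible K) (A : Type u)
    [SA : L.Structure A] [rA : LinearOrder A] (hA : K A SA rA) :
    ∃ (M : Type u) (SM : L.Structure M) (rM : LinearOrder M) (e : A → M),
      IsEmb L true e ∧ K M SM rM ∧ ∀ b, IsHomogeneous L b M := by
  -- Members of the class are bundled so that the chain can be defined by recursion.
  let Obj := {X : Σ X : Type u, L.Structure X × LinearOrder X // K X.1 X.2.1 X.2.2}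
  let : ∀ X : Obj, L.Structure X.1.1 := fun X => X.1.2.1
  let : ∀ X : Obj, LinearOrder X.1.1 := fun X => X.1.2.2
  have step : ∀ X : Obj, ∃ (Y : Obj) (e : X.1.1 → Y.1.1), IsEmb L true e ∧
      ∀ (b : Bool) (s : Set X.1.1) (φ : X.1.1 → X.1.1), IsPartialEmb L b s φ →
        ∃ j : X.1.1 → Y.1.1, IsEmb L b j ∧ ∀ x ∈ s, j x = e (φ x) := fun X => by
    obtain ⟨B, SB, rB, e, he, hB, h⟩ := hK.extend X.1.1 X.2
    exact ⟨⟨⟨B, SB, rB⟩, hB⟩, e, he, h⟩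
  choose next i hi hext using step
  let X : ℕ → Obj := fun n => Nat.rec ⟨⟨A, SA, rA⟩, hA⟩ (fun _ Y => next Y) n
  obtain ⟨D, SD, rD, e, he, hei, hfin⟩ :=
    exists_chain_union (L := L) (fun n => (X n).1.1) (fun n => i (X n)) (fun n => hi (X n))
  refine ⟨D, SD, rD, e 0, he 0, hK.local_finite D fun s hs => ?_, fun b => ?_⟩
  · obtain ⟨n, hn⟩ := hfin s hs
    exact ⟨(X n).1.1, _, _, e n, he n, hn, (X n).2⟩
  · refine isHomogeneous_of_chain (fun n => Set.range (e n)) ?_ (fun x => ?_) fun n Γ hΓ h =>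
      extend_partialIso (he n) (he (n + 1)) (hei n) (hext (X n) b) hΓ h
    · refine monotone_nat_of_le_succ fun n => ?_
      rintro _ ⟨x, rfl⟩
      exact ⟨_, hei n x⟩
    · obtain ⟨n, hn⟩ := hfin {x} (Set.finite_singleton x)
      exact ⟨n, hn rfl⟩

/-- In a relational language finitely generated substructures are finite, so an isomorphism between
them is a finite partial isomorphism. -/
theorem IsHomogeneous.isUltrahomogeneous [L.IsRelational] {M : Type u} [SM : L.Structure M]
    [rM : LinearOrder M] (h : IsHomogeneous L false M) : L.IsUltrahomogeneous M := by
  intro S hS f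
  have := hS.finite
  obtain ⟨g, hg, hgf⟩ := h (Set.range fun x : S => ((x : M), f x)) (Set.finite_range _)
    { inj := by
        rintro _ ⟨x, rfl⟩ _ ⟨y, rfl⟩
        exact Subtype.val_injective.eq_iff.trans f.injective.eq_iff.symm
      rel := fun l R x y hxy => by
        choose z hz using hxy
        have h1 : x = S.subtype ∘ z := funext fun i => (congrArg Prod.fst (hz i)).symm
        have h2 : y = f ∘ z := funext fun i => (congrArg Prod.snd (hz i)).symm
        rw [h1, h2, f.map_rel, S.subtype.map_rel]
      lt_iff := fun hb => by simp at hb }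
  refine ⟨⟨g, fun {n} f => isEmptyElim f, fun {n} R x => hg.rel n R x⟩, ?_⟩
  ext x
  exact (hgf _ ⟨x, rfl⟩).symm

theorem IsHomogeneous.isUltrahomogeneous_ordered [L.IsRelational] {M : Type u} [SM : L.Structure M]
    [rM : LinearOrder M] (h : IsHomogeneous L true M) :
    @FirstOrder.Language.IsUltrahomogeneous (L.sum FirstOrder.Language.order) M
      (orderedStructure SM rM) := by
  let := orderedStructure SM rM
  intro S hS f
  have := hS.finite
  have hlt : ∀ x y : S, f x < f y ↔ (x : M) < y := fun x y => by
    have hle : ∀ x y : S, f x ≤ f y ↔ (x : M) ≤ y := fun x y =>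
      f.map_rel (Sum.inr orderRel.le : (L.sum FirstOrder.Language.order).Relations 2) ![x, y]
    rw [← not_le, ← not_le, hle]
  obtain ⟨g, hg, hgf⟩ := h (Set.range fun x : S => ((x : M), f x)) (Set.finite_range _)
    { inj := by
        rintro _ ⟨x, rfl⟩ _ ⟨y, rfl⟩
        exact Subtype.val_injective.eq_iff.trans f.injective.eq_iff.symm
      rel := fun l R x y hxy => by
        choose z hz using hxy
        have h1 : x = S.subtype ∘ z := funext fun i => (congrArg Prod.fst (hz i)).symm
        have h2 : y = f ∘ z := funext fun i => (congrArg Prod.snd (hz i)).symm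
        rw [h1, h2]
        have ha := f.map_rel (Sum.inl R : (L.sum FirstOrder.Language.order).Relations l) z
        have hb := S.subtype.map_rel (Sum.inl R : (L.sum FirstOrder.Language.order).Relations l) z
        exact hb.trans ha.symm
      lt_iff := by
        rintro - _ ⟨x, rfl⟩ _ ⟨y, rfl⟩
        exact (hlt x y).symm }
  refine ⟨⟨g, fun {n} f => isEmptyElim f, ?_⟩, ?_⟩
  · rintro n (R | R) x
    · exact hg.rel n R x
    · cases R
      exact (hg.mono rfl).le_iff_le
  · ext x
    exact (hgf _ ⟨x, rfl⟩).symm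

/-- A subset of `M` closed under enough automorphisms of `M` is homogeneous. -/
theorem isHomogeneous_subtype {b : Bool} {M : Type u} [SM : L.Structure M] [LinearOrder M]
    (t : Set M) [St : L.Structure t] (hSt : IsEmb L true (Subtype.val : t → M))
    (h : ∀ Γ : Set (M × M), Γ.Finite → Γ ⊆ t ×ˢ t → IsPartialIso L b Γ →
      ∃ g : M ≃ M, IsEmb L b g ∧ (∀ p ∈ Γ, g p.1 = p.2) ∧ ∀ x, g x ∈ t ↔ x ∈ t) :
    IsHomogeneous L b t := by
  intro Γ hfin hΓ
  obtain ⟨g, hg, hgΓ, hgt⟩ := h ((Prod.map Subtype.val Subtype.val) '' Γ) (hfin.image _)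
    (by
      rintro _ ⟨p, -, rfl⟩
      exact ⟨p.1.2, p.2.2⟩)
    { inj := by
        rintro _ ⟨p, hp, rfl⟩ _ ⟨q, hq, rfl⟩
        exact Subtype.val_injective.eq_iff.trans
          ((hΓ.inj p hp q hq).trans Subtype.val_injective.eq_iff.symm)
      rel := fun l R x y hxy => by
        choose z hz hz' using hxy
        have h1 : x = Subtype.val ∘ fun i => (z i).1 := funext fun i =>
          (congrArg Prod.fst (hz' i)).symm
        have h2 : y = Subtype.val ∘ fun i => (z i).2 := funext fun i =>
          (congrArg Prod.snd (hz' i)).symm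
        rw [h1, h2, hSt.rel, hSt.rel]
        exact hΓ.rel l R _ _ hz
      lt_iff := by
        rintro hb _ ⟨p, hp, rfl⟩ _ ⟨q, hq, rfl⟩
        exact hΓ.lt_iff hb p hp q hq }
  let g' : t ≃ t := g.subtypeEquiv fun x => (hgt x).symm
  refine ⟨g', ⟨g'.injective, fun l R x => ?_, fun hb x y hxy => hg.mono hb hxy⟩, fun p hp => ?_⟩
  · rw [← hSt.rel, ← hSt.rel]
    exact hg.rel l R _
  · exact Subtype.ext (hgΓ _ ⟨p, hp, rfl⟩)

/-- A member of an extensible class of infinite cardinality `κ` has a homogeneous ordered extension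
of cardinality `κ` in the class. -/
theorem IsExtensible.exists_extension [L.IsRelational]
    {K : ∀ A : Type u, L.Structure A → LinearOrder A → Prop} (hK : IsExtensible K)
    {κ : Cardinal.{u}} (hκ : ℵ₀ ≤ κ) (A : Type u) (hAκ : #A = κ) (S : L.Structure A)
    (r : LinearOrder A) (hA : K A S r) :
    ∃ (A' : Type u) (S' : L.Structure A') (r' : LinearOrder A'), #A' = κ ∧ K A' S' r' ∧
      IsHomogeneousOrderedExtension S r S' r' := by
  obtain ⟨M, SM, rM, e, he, hM, hhom⟩ := hK.exists_homogeneous A hA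
  obtain ⟨t, hst, ht, hg⟩ := exists_homogeneous_subset hhom hκ (Set.range e)
    (mk_range_le.trans hAκ.le)
  let St : L.Structure t :=
    { funMap := fun {n} f => isEmptyElim f
      RelMap := fun R x => RelMap R (Subtype.val ∘ x) }
  have hval : IsEmb L true (Subtype.val : t → M) :=
    ⟨Subtype.val_injective, fun l R x => Iff.rfl, fun _ x y h => h⟩
  have hhom' : ∀ b, IsHomogeneous L b t := fun b => isHomogeneous_subtype t hval (hg b)
  let e' : A → t := fun x => ⟨e x, hst ⟨x, rfl⟩⟩
  have he' : IsEmb L true e' := ⟨fun x y h => he.inj (congrArg Subtype.val h),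
    fun l R x => he.rel l R x, fun _ x y h => he.mono rfl h⟩
  refine ⟨t, St, inferInstance, ht.antisymm ?_, hK.hereditary t M _ hval hM,
    ⟨⟨he'.toEmbedding⟩, (hhom' false).isUltrahomogeneous, (hhom' true).isUltrahomogeneous_ordered⟩⟩
  rw [← hAκ]
  exact mk_le_of_injective he'.inj

end Extensible

/-! ### Gluing copies of a set along partial maps. -/

section Glue

variable {A F : Type u}

/-- The disjoint union of `A` with, for each `f : F`, a copy of the complement of `D f`. -/
def Glue (D : F → Set A) : Type u := A ⊕ {p : F × A // p.2 ∉ D p.1}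

namespace Glue

/-- The inclusion of `A` into `Glue D`. -/
abbrev base {D : F → Set A} (a : A) : Glue D := Sum.inl a

open Classical in
/-- The map of `A` onto the `f`-th copy of `A` in `Glue D`, glued to `A` by `φ f` on `D f`. -/
noncomputable def copy (D : F → Set A) (φ : F → A → A) (f : F) (a : A) : Glue D :=
  if h : a ∈ D f then Sum.inl (φ f a) else Sum.inr ⟨(f, a), h⟩

variable {D : F → Set A} {φ : F → A → A}

theorem copy_of_mem {f : F} {a : A} (h : a ∈ D f) : copy D φ f a = Sum.inl (φ f a) := dif_pos h

theorem copy_of_notMem {f : F} {a : A} (h : a ∉ D f) : copy D φ f a = Sum.inr ⟨(f, a), h⟩ :=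
  dif_neg h

theorem copy_eq_inl {f : F} {a b : A} (h : copy D φ f a = Sum.inl b) : a ∈ D f ∧ φ f a = b := by
  by_cases ha : a ∈ D f
  · rw [copy_of_mem ha] at h
    exact ⟨ha, Sum.inl.inj h⟩
  · rw [copy_of_notMem ha] at h
    cases h

theorem copy_eq_inr {f : F} {a : A} {p : {p : F × A // p.2 ∉ D p.1}}
    (h : copy D φ f a = Sum.inr p) : f = p.1.1 ∧ a = p.1.2 := by
  by_cases ha : a ∈ D f
  · rw [copy_of_mem ha] at h
    cases h
  · rw [copy_of_notMem ha] at h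
    cases h
    exact ⟨rfl, rfl⟩

theorem mem_of_copy_eq_copy {f g : F} {a b : A} (hfg : f ≠ g)
    (h : copy D φ f a = copy D φ g b) : a ∈ D f ∧ b ∈ D g ∧ φ f a = φ g b := by
  by_cases ha : a ∈ D f
  · rw [copy_of_mem ha] at h
    obtain ⟨hb, h⟩ := copy_eq_inl h.symm
    exact ⟨ha, hb, h.symm⟩
  · rw [copy_of_notMem ha] at h
    exact absurd (copy_eq_inr h.symm).1.symm hfg

theorem inr_eq_copy (p : {p : F × A // p.2 ∉ D p.1}) :
    (Sum.inr p : Glue D) = copy D φ p.1.1 p.1.2 := (copy_of_notMem p.2).symm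

theorem copy_injective {f : F} (h : Set.InjOn (φ f) (D f)) :
    Function.Injective (copy D φ f) := by
  intro a b hab
  by_cases hb : b ∈ D f
  · rw [copy_of_mem hb] at hab
    obtain ⟨ha, hab⟩ := copy_eq_inl hab
    exact h ha hb hab
  · rw [copy_of_notMem hb] at hab
    exact (copy_eq_inr hab).2

/-! ### The linear order on the gluing. -/

section Order

variable [LinearOrder A]

/-- The sort key of an element of `Glue D`. An element outside `A` is placed above the images of the
elements of `D f` which precede it in the sense of `prec f`. -/
noncomputable def key (φ : F → A → A) (prec : F → A → A → Prop) :
    Glue D → LowerSet A ×ₗ WithBot (F ×ₗ A)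
  -- The entry `⊥` puts `a` below the new points whose cut is `Iic a`. Among new points with the
  -- same cut, the pair of index and point breaks the tie.
  | Sum.inl a => toLex (LowerSet.Iic a, ⊥)
  | Sum.inr p => toLex (lowerClosure (φ p.1.1 '' {d ∈ D p.1.1 | prec p.1.1 d p.1.2}),
      ((toLex p.1 : F ×ₗ A) : WithBot (F ×ₗ A)))

theorem key_injective (prec : F → A → A → Prop) :
    Function.Injective (key (D := D) φ prec) := by
  rintro (a | p) (b | q) h
  · have h1 := congrArg (fun x => (ofLex x).1) h
    exact congrArg Sum.inl (LowerSet.Iic_injective h1)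
  · have h1 := congrArg (fun x => (ofLex x).2) h
    simp [key] at h1
  · have h1 := congrArg (fun x => (ofLex x).2) h
    simp [key] at h1
  · have h1 := congrArg (fun x => (ofLex x).2) h
    simp only [key, ofLex_toLex, WithBot.coe_inj] at h1
    exact congrArg Sum.inr (Subtype.ext (toLex.injective h1))

variable [LinearOrder F]

/-- The linear order on `Glue D` given by the sort key. -/
@[reducible]
noncomputable def linearOrder (φ : F → A → A) (prec : F → A → A → Prop) : LinearOrder (Glue D) :=
  LinearOrder.lift' (key φ prec) (key_injective prec)

theorem inl_lt_inl (φ : F → A → A) (prec : F → A → A → Prop) {a b : A} (h : a < b) :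
    (linearOrder φ prec).lt (base a : Glue D) (base b) :=
  Prod.Lex.toLex_lt_toLex.2 (Or.inl (LowerSet.Iic_strictMono _ h))

/-- By transitivity of `prec f`, the cut of a new point grows along it. A glued `a` lies in the cut
of a new `b`, with `⊥` settling equality. A glued `b` lies strictly above all generators of the cut
of a new `a`. Two new points with equal cuts are ordered as in `A`. -/
theorem copy_lt_copy {prec : F → A → A → Prop} {f : F}
    (hprec : ∀ a b c, prec f a b → prec f b c → prec f a c)
    (hφ : ∀ a ∈ D f, ∀ b ∈ D f, prec f a b → φ f a < φ f b) {a b : A} (hab : prec f a b)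
    (hlt : a < b) : (linearOrder φ prec).lt (copy D φ f a) (copy D φ f b) := by
  by_cases ha : a ∈ D f <;> by_cases hb : b ∈ D f
  · rw [copy_of_mem ha, copy_of_mem hb]
    exact inl_lt_inl φ prec (hφ a ha b hb hab)
  · rw [copy_of_mem ha, copy_of_notMem hb]
    refine Prod.Lex.toLex_lt_toLex'.2 ⟨?_, fun _ => WithBot.bot_lt_coe _⟩
    intro c hc
    exact mem_lowerClosure.2 ⟨φ f a, ⟨a, ⟨ha, hab⟩, rfl⟩, hc⟩
  · rw [copy_of_notMem ha, copy_of_mem hb]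
    refine Prod.Lex.toLex_lt_toLex.2 (Or.inl (lt_of_le_of_ne ?_ ?_))
    · intro c hc
      obtain ⟨_, ⟨d, ⟨hd, hda⟩, rfl⟩, hcd⟩ := mem_lowerClosure.1 hc
      exact hcd.trans (hφ d hd b hb (hprec d a b hda hab)).le
    · intro h
      have hmem : φ f b ∈ lowerClosure (φ f '' {d ∈ D f | prec f d a}) :=
        (SetLike.ext_iff.1 h (φ f b)).2 (le_refl _)
      obtain ⟨_, ⟨d, ⟨hd, hda⟩, rfl⟩, hcd⟩ := mem_lowerClosure.1 hmem
      exact absurd hcd (not_le.2 (hφ d hd b hb (hprec d a b hda hab)))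
  · rw [copy_of_notMem ha, copy_of_notMem hb]
    refine Prod.Lex.toLex_lt_toLex'.2 ⟨?_, fun _ => WithBot.coe_lt_coe.2 ?_⟩
    · refine lowerClosure_mono (Set.image_mono ?_)
      exact fun d hd => ⟨hd.1, hprec d a b hd.2 hab⟩
    · exact Prod.Lex.toLex_lt_toLex.2 (Or.inr ⟨rfl, hlt⟩)

end Order

/-! ### The amalgam of partial orders on the gluing. -/

section PosetLe

variable {R : A → A → Prop}

/-- The element `x` of `Glue D` lies above `c` in the amalgam of the partial orders. -/
def Above (R : A → A → Prop) (φ : F → A → A) (c : A) : Glue D → Prop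
  | Sum.inl a => R c a
  | Sum.inr p => ∃ d ∈ D p.1.1, R c (φ p.1.1 d) ∧ R d p.1.2

/-- The element `x` of `Glue D` lies below `c` in the amalgam of the partial orders. -/
def Below (R : A → A → Prop) (φ : F → A → A) (c : A) : Glue D → Prop
  | Sum.inl a => R a c
  | Sum.inr p => ∃ d ∈ D p.1.1, R (φ p.1.1 d) c ∧ R p.1.2 d

/-- The amalgam on `Glue D` of the copies of a partial order `R` on `A`. -/
def PosetLe (R : A → A → Prop) (φ : F → A → A) (x y : Glue D) : Prop :=
  (∃ f a b, x = copy D φ f a ∧ y = copy D φ f b ∧ R a b) ∨ ∃ c, Below R φ c x ∧ Above R φ c y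

/-- `R` is a preorder and the maps `φ f` on `D f` preserve and reflect it. -/
structure IsCompatible (R : A → A → Prop) (D : F → Set A) (φ : F → A → A) : Prop where
  refl : ∀ a, R a a
  trans : ∀ {a b c}, R a b → R b c → R a c
  map_iff : ∀ {f a b}, a ∈ D f → b ∈ D f → (R (φ f a) (φ f b) ↔ R a b)

/-- The formula for new points remains valid for glued ones, which are their own witnesses, so later
arguments need no case split. -/
theorem above_copy (hR : IsCompatible R D φ) {c : A} {f : F} {a : A} :
    Above R φ c (copy D φ f a) ↔ ∃ d ∈ D f, R c (φ f d) ∧ R d a := by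
  by_cases ha : a ∈ D f
  · rw [copy_of_mem ha]
    exact ⟨fun h => ⟨a, ha, h, hR.refl a⟩,
      fun ⟨d, hd, h1, h2⟩ => hR.trans h1 ((hR.map_iff hd ha).2 h2)⟩
  · rw [copy_of_notMem ha]
    rfl

theorem below_copy (hR : IsCompatible R D φ) {c : A} {f : F} {a : A} :
    Below R φ c (copy D φ f a) ↔ ∃ d ∈ D f, R (φ f d) c ∧ R a d := by
  by_cases ha : a ∈ D f
  · rw [copy_of_mem ha]
    exact ⟨fun h => ⟨a, ha, h, hR.refl a⟩,
      fun ⟨d, hd, h1, h2⟩ => hR.trans ((hR.map_iff ha hd).2 h2) h1⟩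
  · rw [copy_of_notMem ha]
    rfl

theorem Above.of_rel (hR : IsCompatible R D φ) {c c' : A} {x : Glue D} (h : R c' c)
    (hx : Above R φ c x) : Above R φ c' x := by
  rcases x with a | p
  · exact hR.trans h hx
  · obtain ⟨d, hd, h1, h2⟩ := hx
    exact ⟨d, hd, hR.trans h h1, h2⟩

theorem Below.of_rel (hR : IsCompatible R D φ) {c c' : A} {x : Glue D} (h : R c c')
    (hx : Below R φ c x) : Below R φ c' x := by
  rcases x with a | p
  · exact hR.trans hx h
  · obtain ⟨d, hd, h1, h2⟩ := hx
    exact ⟨d, hd, hR.trans h1 h, h2⟩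

/-- The two witnesses are comparable within one copy, and `φ` carries this comparison to `A`. -/
theorem rel_of_above_of_below (hR : IsCompatible R D φ) {c c' : A} {x : Glue D}
    (h : Above R φ c x) (h' : Below R φ c' x) : R c c' := by
  rcases x with a | p
  · exact hR.trans h h'
  · obtain ⟨d, hd, h1, h2⟩ := h
    obtain ⟨d', hd', h1', h2'⟩ := h'
    exact hR.trans h1 (hR.trans ((hR.map_iff hd hd').2 (hR.trans h2 h2')) h1')

theorem posetLe_inl_right (hR : IsCompatible R D φ) {x : Glue D} {b : A} :
    PosetLe R φ x (Sum.inl b) ↔ Below R φ b x := by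
  constructor
  · rintro (⟨f, a, b', rfl, h, hab⟩ | ⟨c, h1, h2⟩)
    · obtain ⟨hb, rfl⟩ := copy_eq_inl h.symm
      exact (below_copy hR).2 ⟨b', hb, hR.refl _, hab⟩
    · exact Below.of_rel hR h2 h1
  · exact fun h => Or.inr ⟨b, h, hR.refl b⟩

theorem posetLe_inl_left (hR : IsCompatible R D φ) {x : Glue D} {b : A} :
    PosetLe R φ (Sum.inl b) x ↔ Above R φ b x := by
  constructor
  · rintro (⟨f, b', a, h, rfl, hab⟩ | ⟨c, h1, h2⟩)
    · obtain ⟨hb, rfl⟩ := copy_eq_inl h.symm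
      exact (above_copy hR).2 ⟨b', hb, hR.refl _, hab⟩
    · exact Above.of_rel hR h1 h2
  · exact fun h => Or.inr ⟨b, hR.refl b, h⟩

/-- Points shared by two copies are glued, so both maps transfer their relation to `A`. A comparison
through `c` is pulled back along `φ f` by way of its two witnesses. -/
theorem posetLe_copy (hR : IsCompatible R D φ) (hinj : ∀ f, Set.InjOn (φ f) (D f))
    {f : F} {a b : A} : PosetLe R φ (copy D φ f a) (copy D φ f b) ↔ R a b := by
  constructor
  · rintro (⟨g, a', b', ha, hb, hab⟩ | ⟨c, h1, h2⟩)
    · rcases eq_or_ne f g with rfl | hfg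
      · rwa [copy_injective (hinj f) ha, copy_injective (hinj f) hb]
      · obtain ⟨ha1, ha2, ha3⟩ := mem_of_copy_eq_copy hfg ha
        obtain ⟨hb1, hb2, hb3⟩ := mem_of_copy_eq_copy hfg hb
        rwa [← hR.map_iff ha1 hb1, ha3, hb3, hR.map_iff ha2 hb2]
    · obtain ⟨d, hd, h3, h4⟩ := (below_copy hR).1 h1
      obtain ⟨d', hd', h3', h4'⟩ := (above_copy hR).1 h2
      exact hR.trans h4 (hR.trans ((hR.map_iff hd hd').1 (hR.trans h3 h3')) h4')
  · exact fun h => Or.inl ⟨f, a, b, rfl, rfl, h⟩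

theorem posetLe_refl (hR : IsCompatible R D φ) (x : Glue D) : PosetLe R φ x x := by
  rcases x with a | p
  · exact Or.inr ⟨a, hR.refl a, hR.refl a⟩
  · exact Or.inl ⟨p.1.1, p.1.2, p.1.2, inr_eq_copy p, inr_eq_copy p, hR.refl _⟩

/-- A middle point in `A` is itself the mediator. A new middle point belongs to one copy only, so
two comparisons inside copies compose there, and one inside a copy is absorbed by one through `A`.
-/
theorem posetLe_trans (hR : IsCompatible R D φ) {x y z : Glue D} (hxy : PosetLe R φ x y)
    (hyz : PosetLe R φ y z) : PosetLe R φ x z := by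
  rcases y with b | p
  · exact Or.inr ⟨b, (posetLe_inl_right hR).1 hxy, (posetLe_inl_left hR).1 hyz⟩
  · rcases hxy with ⟨f, a, b, rfl, hy, hab⟩ | ⟨c, h1, h2⟩ <;>
      rcases hyz with ⟨f', b', e, hy', rfl, hbe⟩ | ⟨c', h1', h2'⟩
    · obtain ⟨rfl, rfl⟩ := copy_eq_inr hy.symm
      obtain ⟨rfl, rfl⟩ := copy_eq_inr hy'.symm
      exact Or.inl ⟨_, a, e, rfl, rfl, hR.trans hab hbe⟩
    · rw [hy, below_copy hR] at h1'
      obtain ⟨d, hd, h3, h4⟩ := h1'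
      exact Or.inr ⟨c', (below_copy hR).2 ⟨d, hd, h3, hR.trans hab h4⟩, h2'⟩
    · rw [hy', above_copy hR] at h2
      obtain ⟨d, hd, h3, h4⟩ := h2
      exact Or.inr ⟨c, h1, (above_copy hR).2 ⟨d, hd, h3, hR.trans h4 hbe⟩⟩
    · exact Or.inr ⟨c', Below.of_rel hR (rel_of_above_of_below hR h2 h1') h1, h2'⟩

/-- A linear order on `Glue D` extends the amalgam of the partial orders as soon as it does so on `A`
and on each of its copies. -/
theorem le_of_posetLe [LinearOrder (Glue D)]
    (hinl : ∀ a b, R a b → (base a : Glue D) ≤ base b)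
    (hcopy : ∀ f a b, R a b → copy D φ f a ≤ copy D φ f b) {x y : Glue D}
    (h : PosetLe R φ x y) : x ≤ y := by
  rcases h with ⟨f, a, b, rfl, rfl, hab⟩ | ⟨c, h1, h2⟩
  · exact hcopy f a b hab
  · refine le_trans (b := (base c : Glue D)) ?_ ?_
    · rcases x with a | p
      · exact hinl _ _ h1
      · obtain ⟨d, hd, h3, h4⟩ := h1
        rw [inr_eq_copy (φ := φ) p]
        refine (hcopy _ _ _ h4).trans ?_
        rw [copy_of_mem hd]
        exact hinl _ _ h3
    · rcases y with a | p
      · exact hinl _ _ h2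
      · obtain ⟨d, hd, h3, h4⟩ := h2
        rw [inr_eq_copy (φ := φ) p]
        refine le_trans ?_ (hcopy _ _ _ h4)
        rw [copy_of_mem hd]
        exact hinl _ _ h3

end PosetLe

end Glue

end Glue

/-! ### Gluing along all partial self-embeddings. -/

section GlueStructure

variable (L : FirstOrder.Language.{v, v'}) (A : Type u) [L.Structure A] [LinearOrder A]

/-- The partial self-embeddings of `A`, order preserving or not. -/
abbrev PartialEmbs : Type u := {p : Bool × Set A × (A → A) // IsPartialEmb L p.1 p.2.1 p.2.2}

variable {L A}

/-- The domain of a partial self-embedding. -/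
abbrev PartialEmbs.dom (f : PartialEmbs L A) : Set A := f.1.2.1

/-- The function underlying a partial self-embedding. -/
abbrev PartialEmbs.map (f : PartialEmbs L A) : A → A := f.1.2.2

theorem PartialEmbs.copy_injective (f : PartialEmbs L A) :
    Function.Injective (Glue.copy PartialEmbs.dom PartialEmbs.map f) :=
  Glue.copy_injective f.2.inj

theorem PartialEmbs.prec_map_lt {P : A → A → Prop}
    (hP : ∀ f : PartialEmbs L A, ∀ a ∈ f.dom, ∀ b ∈ f.dom, P a b → P (f.map a) (f.map b))
    (hle : ∀ a b, P a b → a ≤ b) (f : PartialEmbs L A) {a b : A} (ha : a ∈ f.dom) (hb : b ∈ f.dom)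
    (h : (f.1.1 = true ∨ P a b) ∧ a < b) : f.map a < f.map b := by
  rcases h with ⟨h | h, hab⟩
  · exact f.2.mono h ha hb hab
  · exact lt_of_le_of_ne (hle _ _ (hP f a ha b hb h)) fun h' => hab.ne (f.2.inj ha hb h')

/-- The gluing along all partial self-embeddings, with the linear order determined by a relation `P`
contained in `≤`, provides an extension as required in `IsExtensible`. -/
theorem extend_glue [LinearOrder (PartialEmbs L A)] {P : A → A → Prop}
    (hP : ∀ f : PartialEmbs L A, ∀ a ∈ f.dom, ∀ b ∈ f.dom, P a b → P (f.map a) (f.map b))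
    (hle : ∀ a b, P a b → a ≤ b) (htr : ∀ a b c, P a b → P b c → P a c)
    [L.Structure (Glue (PartialEmbs.dom (L := L) (A := A)))]
    (hinl : ∀ (l : ℕ) (R : L.Relations l) (h : Fin l → A),
      RelMap R ((Glue.base (D := PartialEmbs.dom (L := L) (A := A))) ∘ h) ↔ RelMap R h)
    (hcopy : ∀ (f : PartialEmbs L A) (l : ℕ) (R : L.Relations l) (h : Fin l → A),
      RelMap R (Glue.copy PartialEmbs.dom PartialEmbs.map f ∘ h) ↔ RelMap R h) :
    ∃ _rB : LinearOrder (Glue (PartialEmbs.dom (L := L) (A := A))),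
      IsEmb L true (Glue.base (D := PartialEmbs.dom (L := L) (A := A))) ∧
      (∀ (f : PartialEmbs L A) (a b : A), P a b → Glue.copy PartialEmbs.dom PartialEmbs.map f a ≤
        Glue.copy PartialEmbs.dom PartialEmbs.map f b) ∧
      ∀ (b : Bool) (s : Set A) (φ : A → A), IsPartialEmb L b s φ →
        ∃ j : A → Glue (PartialEmbs.dom (L := L)), IsEmb L b j ∧ ∀ x ∈ s, j x = Glue.base (φ x) := by
  -- An order-preserving `f` lets its copy keep the whole order of `A`; any other `f` may reverse
  -- it, so its copy is only made to respect `P`.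
  let prec : PartialEmbs L A → A → A → Prop := fun f a b => (f.1.1 = true ∨ P a b) ∧ a < b
  have hprec : ∀ f a b c, prec f a b → prec f b c → prec f a c := by
    rintro f a b c ⟨h1, h2⟩ ⟨h3, h4⟩
    refine ⟨?_, h2.trans h4⟩
    rcases h1 with h1 | h1
    · exact Or.inl h1
    · exact h3.imp_right (htr _ _ _ h1)
  have hlt : ∀ (f : PartialEmbs L A) (a b : A), prec f a b →
      (Glue.linearOrder PartialEmbs.map prec).lt (Glue.copy PartialEmbs.dom PartialEmbs.map f a)
        (Glue.copy PartialEmbs.dom PartialEmbs.map f b) := fun f a b h =>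
    Glue.copy_lt_copy (hprec f) (fun a ha b hb h => f.prec_map_lt hP hle ha hb h) h h.2
  let rB := Glue.linearOrder (D := PartialEmbs.dom (L := L) (A := A)) PartialEmbs.map prec
  refine ⟨rB, ⟨Sum.inl_injective, hinl, fun _ a b h => Glue.inl_lt_inl _ _ h⟩, ?_, ?_⟩
  · intro f a b h
    rcases (hle a b h).eq_or_lt with rfl | hab
    · exact le_rfl
    · exact (hlt f a b ⟨Or.inr h, hab⟩).le
  · intro b s φ h
    let f : PartialEmbs L A := ⟨(b, s, φ), h⟩
    refine ⟨Glue.copy PartialEmbs.dom PartialEmbs.map f,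
      ⟨f.copy_injective, hcopy f, fun hb x y hxy => hlt f x y ⟨Or.inl hb, hxy⟩⟩,
      fun x hx => Glue.copy_of_mem hx⟩

end GlueStructure

/-! ### Free amalgams of hypergraphs. -/

section Hypergraph

variable {L : FirstOrder.Language.{v, v'}}

/-- An embedding whose range lies in the range of another embedding factors through it. -/
theorem nonempty_embedding_of_range_subset [L.IsRelational] {H A B : Type*}
    [L.Structure H] [L.Structure A] [L.Structure B] {e : A → B}
    (hrel : ∀ (l : ℕ) (R : L.Relations l) (h : Fin l → A), RelMap R (e ∘ h) ↔ RelMap R h)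
    (g : L.Embedding H B) (hg : ∀ x, g x ∈ Set.range e) : Nonempty (L.Embedding H A) := by
  choose k hk using hg
  have hk' : e ∘ k = g := funext hk
  refine ⟨⟨⟨k, fun x y hxy => g.injective ?_⟩, fun {n} f => isEmptyElim f, fun {n} R x => ?_⟩⟩
  · rw [← hk, ← hk]
    exact congrArg e hxy
  · change RelMap R (k ∘ x) ↔ _
    rw [← hrel, ← Function.comp_assoc, hk', g.map_rel]

/-- The free amalgam of `A` and its copies, as a structure on the gluing. -/
@[reducible]
def glueStructure [L.IsRelational] (A : Type u) [L.Structure A] [LinearOrder A] :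
    L.Structure (Glue (PartialEmbs.dom (L := L) (A := A))) where
  funMap f := isEmptyElim f
  RelMap R h := (∃ x, h = Glue.base ∘ x ∧ RelMap R x) ∨
    ∃ f x, h = Glue.copy PartialEmbs.dom PartialEmbs.map f ∘ x ∧ RelMap R x

section

variable [L.IsRelational] {A : Type u} [L.Structure A] [LinearOrder A]

theorem glueStructure_base (l : ℕ) (R : L.Relations l) (h : Fin l → A) :
    (glueStructure A).RelMap R (Glue.base ∘ h) ↔ RelMap R h := by
  refine ⟨?_, fun hh => Or.inl ⟨h, rfl, hh⟩⟩
  rintro (⟨x, hx, hR⟩ | ⟨f, x, hx, hR⟩)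
  · rwa [Sum.inl_injective.comp_left hx]
  · have h1 := fun i => Glue.copy_eq_inl (congrFun hx i).symm
    have h2 : f.map ∘ x = h := funext fun i => (h1 i).2
    rwa [← h2, f.2.rel l R x fun i => (h1 i).1]

/-- A tuple that also comes from `A` or from another copy consists of glued points, and partial
embeddings preserve and reflect relations there. -/
theorem glueStructure_copy (f : PartialEmbs L A) (l : ℕ) (R : L.Relations l) (h : Fin l → A) :
    (glueStructure A).RelMap R (Glue.copy PartialEmbs.dom PartialEmbs.map f ∘ h) ↔ RelMap R h := by
  refine ⟨?_, fun hh => Or.inr ⟨f, h, rfl, hh⟩⟩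
  rintro (⟨x, hx, hR⟩ | ⟨g, x, hx, hR⟩)
  · have h1 := fun i => Glue.copy_eq_inl (congrFun hx i)
    have h2 : f.map ∘ h = x := funext fun i => (h1 i).2
    rwa [← f.2.rel l R h fun i => (h1 i).1, h2]
  · rcases eq_or_ne f g with rfl | hfg
    · rwa [f.copy_injective.comp_left hx]
    · have h1 := fun i => Glue.mem_of_copy_eq_copy hfg (congrFun hx i)
      have h2 : f.map ∘ h = g.map ∘ x := funext fun i => (h1 i).2.2
      rwa [← f.2.rel l R h fun i => (h1 i).1, h2, g.2.rel l R x fun i => (h1 i).2.1]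

theorem isHypergraph_glueStructure (hA : IsHypergraph (inferInstance : L.Structure A)) :
    IsHypergraph (glueStructure (L := L) A) := by
  rintro l R _ (⟨x, rfl, hR⟩ | ⟨f, x, rfl, hR⟩)
  · exact ⟨Sum.inl_injective.comp (hA l R x hR).1,
      fun σ => Or.inl ⟨x ∘ σ, rfl, (hA l R x hR).2 σ⟩⟩
  · exact ⟨f.copy_injective.comp (hA l R x hR).1,
      fun σ => Or.inr ⟨f, x ∘ σ, rfl, (hA l R x hR).2 σ⟩⟩

/-- An irreducible structure embedding into the free amalgam embeds into `A`. -/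
theorem nonempty_embedding_of_glueStructure {H : Type*} [SH : L.Structure H]
    (hH : IsIrreducibleHypergraph SH)
    (g : @FirstOrder.Language.Embedding L H (Glue (PartialEmbs.dom (L := L) (A := A))) SH
      (glueStructure A)) : Nonempty (L.Embedding H A) := by
  let _ := glueStructure (L := L) A
  -- If some vertex of `H` is sent outside `A`, it lies in exactly one copy. Irreducibility joins it
  -- to every other vertex by a hyperedge, which must lie in that copy too.
  by_cases hall : ∀ x, g x ∈ Set.range (Glue.base (D := PartialEmbs.dom (L := L) (A := A)))
  · exact nonempty_embedding_of_range_subset glueStructure_base g hall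
  · push Not at hall
    obtain ⟨x, hx⟩ := hall
    rcases hgx : g x with a | p
    · exact absurd ⟨a, hgx.symm⟩ hx
    · refine nonempty_embedding_of_range_subset (glueStructure_copy p.1.1) g fun y => ?_
      by_cases hxy : x = y
      · exact ⟨p.1.2, by rw [← hxy, hgx]; exact (Glue.inr_eq_copy p).symm⟩
      · obtain ⟨l, R, h, hR, ⟨i, rfl⟩, ⟨j, rfl⟩⟩ := hH.2 x y hxy
        rcases (g.map_rel R h).2 hR with ⟨z, hz, -⟩ | ⟨f, z, hz, -⟩
        · exact absurd ⟨z i, (congrFun hz i).symm⟩ hx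
        · have h1 : g (h i) = Glue.copy PartialEmbs.dom PartialEmbs.map f (z i) := congrFun hz i
          rw [hgx] at h1
          obtain ⟨rfl, -⟩ := Glue.copy_eq_inr h1.symm
          exact ⟨z j, (congrFun hz j).symm⟩

end

/-- Hypergraphs omitting a class of finite irreducible hypergraphs form an extensible class. -/
theorem isExtensible_hypergraph [L.IsRelational] (𝒜 : Set (CategoryTheory.Bundled.{w} L.Structure))
    (h𝒜 : ∀ H ∈ 𝒜, Finite H ∧ IsIrreducibleHypergraph H.str) :
    IsExtensible.{u} fun (A : Type u) (S : L.Structure A) (_ : LinearOrder A) =>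
      IsHypergraph S ∧ IsFreeOf 𝒜 S where
  hereditary A B SA rA SB rB e he := by
    rintro ⟨hB, hB'⟩
    refine ⟨fun l R h hR => ?_, fun H hH => ⟨fun g => (hB' H hH).false ?_⟩⟩
    · obtain ⟨h1, h2⟩ := hB l R (e ∘ h) ((he.rel l R h).2 hR)
      exact ⟨h1.of_comp, fun σ => (he.rel l R (h ∘ σ)).1 (h2 σ)⟩
    · let _ := H.str
      exact ⟨⟨e ∘ g, he.inj.comp g.injective⟩, fun {n} f => isEmptyElim f,
        fun {n} R x => (he.rel n R (g ∘ x)).trans (g.map_rel R x)⟩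
  local_finite D SD rD hD := by
    refine ⟨fun l R h hR => ?_, fun H hH => ⟨fun g => ?_⟩⟩
    · obtain ⟨A, SA, rA, e, he, hs, hA, -⟩ := hD (Set.range h) (Set.finite_range h)
      choose k hk using fun i => hs ⟨i, rfl⟩
      obtain rfl : e ∘ k = h := funext hk
      obtain ⟨h1, h2⟩ := hA l R k ((he.rel l R k).1 hR)
      exact ⟨he.inj.comp h1, fun σ => (he.rel l R (k ∘ σ)).2 (h2 σ)⟩
    · let _ := H.str
      -- Finiteness of `H` confines its image to a single member of the local cover.
      have := (h𝒜 H hH).1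
      obtain ⟨A, SA, rA, e, he, hs, -, hA⟩ := hD (Set.range g) (Set.finite_range g)
      obtain ⟨g'⟩ := nonempty_embedding_of_range_subset he.rel g fun x => hs ⟨x, rfl⟩
      exact (hA H hH).false g'
  extend A SA rA := by
    rintro ⟨hA, hA'⟩
    -- Any linear order on the indices would do, as it only breaks ties between cuts.
    obtain ⟨_, -⟩ := exists_wellFoundedLT (PartialEmbs L A)
    let _ := glueStructure (L := L) A
    obtain ⟨rB, h1, -, h2⟩ := extend_glue (L := L) (A := A) (P := fun _ _ => False)
      (fun _ _ _ _ _ => False.elim) (fun _ _ => False.elim) (fun _ _ _ => False.elim)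
      glueStructure_base glueStructure_copy
    exact ⟨_, glueStructure A, rB, Glue.base, h1, ⟨isHypergraph_glueStructure hA, fun H hH =>
      ⟨fun g => (nonempty_embedding_of_glueStructure (SH := H.str) (h𝒜 H hH).2 g).elim
        (hA' H hH).false⟩⟩, h2⟩

end Hypergraph

/-! ### Posets with a linear extension. -/

section Poset

/-- The binary relation underlying a structure in the language of orders. -/
abbrev leRel {A : Type u} (S : FirstOrder.Language.order.Structure A) (a b : A) : Prop :=
  S.RelMap orderRel.le ![a, b]

/-- The structure in the language of orders given by a binary relation. -/
@[reducible]
def structureOfRel {A : Type u} (R : A → A → Prop) : FirstOrder.Language.order.Structure A where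
  funMap f := isEmptyElim f
  RelMap | .le => fun x => R (x 0) (x 1)

theorem relMap_iff_leRel {A : Type u} (S : FirstOrder.Language.order.Structure A) (x : Fin 2 → A) :
    S.RelMap orderRel.le x ↔ leRel S (x 0) (x 1) := by
  have : x = ![x 0, x 1] := by ext i; fin_cases i <;> rfl
  rw [leRel, ← this]

theorem relMap_comp_iff {A B : Type u} [SA : FirstOrder.Language.order.Structure A]
    [SB : FirstOrder.Language.order.Structure B] {e : A → B}
    (h : ∀ a b, leRel SB (e a) (e b) ↔ leRel SA a b) (l : ℕ)
    (R : FirstOrder.Language.order.Relations l) (x : Fin l → A) :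
    RelMap R (e ∘ x) ↔ RelMap R x := by
  cases R
  rw [relMap_iff_leRel, relMap_iff_leRel]
  exact h _ _

theorem IsEmb.leRel_iff {b : Bool} {A B : Type u} [SA : FirstOrder.Language.order.Structure A]
    [LinearOrder A] [SB : FirstOrder.Language.order.Structure B] [LinearOrder B] {e : A → B}
    (he : IsEmb FirstOrder.Language.order b e) (x y : A) :
    leRel SB (e x) (e y) ↔ leRel SA x y := by
  have := he.rel 2 orderRel.le ![x, y]
  rwa [relMap_iff_leRel] at this

theorem isCompatible_leRel {A : Type u} [S : FirstOrder.Language.order.Structure A] [LinearOrder A]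
    (hr : ∀ a, leRel S a a) (ht : ∀ a b c, leRel S a b → leRel S b c → leRel S a c) :
    Glue.IsCompatible (leRel S) (PartialEmbs.dom (L := FirstOrder.Language.order))
      PartialEmbs.map where
  refl := hr
  trans := ht _ _ _
  map_iff {f a b} ha hb := by
    have := f.2.rel 2 orderRel.le ![a, b] (by intro i; fin_cases i <;> assumption)
    rwa [relMap_iff_leRel] at this

/-- Partial orders with a linear extension form an extensible class. -/
theorem isExtensible_poset :
    IsExtensible.{u} fun (A : Type u) (S : FirstOrder.Language.order.Structure A)
      (r : LinearOrder A) => (∀ a, leRel S a a) ∧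
        (∀ a b c, leRel S a b → leRel S b c → leRel S a c) ∧ ∀ a b, leRel S a b → r.le a b where
  hereditary A B SA rA SB rB e he := by
    rintro ⟨hr, ht, hle⟩
    simp only [← he.leRel_iff]
    exact ⟨fun a => hr _, fun a b c => ht _ _ _,
      fun a b h => (he.mono rfl).le_iff_le.1 (hle _ _ h)⟩
  local_finite D SD rD hD := by
    have h3 : ∀ a b c : D, leRel SD a a ∧ (leRel SD a b → leRel SD b c → leRel SD a c) ∧
        (leRel SD a b → a ≤ b) := by
      intro a b c
      obtain ⟨A, SA, rA, e, he, hs, hr, ht, hle⟩ := hD {a, b, c} (by simp)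
      obtain ⟨a, rfl⟩ := hs (show a ∈ _ by simp)
      obtain ⟨b, rfl⟩ := hs (show b ∈ _ by simp)
      obtain ⟨c, rfl⟩ := hs (show c ∈ _ by simp)
      simp only [he.leRel_iff, (he.mono rfl).le_iff_le]
      exact ⟨hr a, ht a b c, hle a b⟩
    exact ⟨fun a => (h3 a a a).1, fun a b c => (h3 a b c).2.1, fun a b => (h3 a b b).2.2⟩
  extend A SA rA := by
    rintro ⟨hr, ht, hle⟩
    obtain ⟨_, -⟩ := exists_wellFoundedLT (PartialEmbs FirstOrder.Language.order A)
    have hc := isCompatible_leRel hr ht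
    let SB : FirstOrder.Language.order.Structure
        (Glue (PartialEmbs.dom (L := FirstOrder.Language.order) (A := A))) :=
      structureOfRel (Glue.PosetLe (leRel SA) PartialEmbs.map)
    obtain ⟨rB, h1, h1', h2⟩ := extend_glue (L := FirstOrder.Language.order) (A := A)
      (P := leRel SA) (fun f a ha b hb => (hc.map_iff ha hb).2) hle ht
      (relMap_comp_iff fun a b => Glue.posetLe_inl_left hc)
      (fun f => relMap_comp_iff fun a b => Glue.posetLe_copy hc fun f => f.2.inj)
    refine ⟨_, SB, rB, Glue.base, h1, ⟨fun x => Glue.posetLe_refl hc x,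
      fun x y z => Glue.posetLe_trans hc, fun x y => Glue.le_of_posetLe
        (fun a b h => (h1.mono rfl).le_iff_le.2 (hle a b h)) h1'⟩, h2⟩

end Poset

/-! ### Graphs as hypergraphs with one binary relation. -/

section Graph

theorem isHypergraph_graph {A : Type u} (G : SimpleGraph A) : IsHypergraph G.structure := by
  rintro _ ⟨⟩ h (hh : G.Adj (h 0) (h 1))
  refine ⟨fun i j hij => ?_, fun σ => ?_⟩
  · fin_cases i <;> fin_cases j
    · rfl
    · exact absurd hij hh.ne
    · exact absurd hij hh.ne'
    · rfl
  · change G.Adj (h (σ 0)) (h (σ 1))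
    have h01 : σ 0 ≠ σ 1 := fun h => by simpa using σ.injective h
    generalize σ 0 = i at h01
    generalize σ 1 = j at h01
    fin_cases i <;> fin_cases j
    · exact absurd rfl h01
    · exact hh
    · exact hh.symm
    · exact absurd rfl h01

/-- Invariance under the transposition gives symmetry, and distinctness of entries excludes loops.
-/
theorem exists_graph_of_isHypergraph {A : Type u} (S : FirstOrder.Language.graph.Structure A)
    (hS : IsHypergraph S) : ∃ G : SimpleGraph A, G.structure = S := by
  have hswap : ∀ a b : A, ![a, b] ∘ Equiv.swap (0 : Fin 2) 1 = ![b, a] := fun a b => by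
    ext i; fin_cases i <;> simp
  refine ⟨⟨fun a b => S.RelMap graphRel.adj ![a, b], ⟨fun a b h => ?_⟩, ⟨fun a h => ?_⟩⟩, ?_⟩
  · have := (hS 2 _ _ h).2 (Equiv.swap 0 1)
    rwa [hswap] at this
  · have := (hS 2 _ _ h).1 (a₁ := 0) (a₂ := 1) rfl
    simp at this
  · ext n f x
    · exact isEmptyElim f
    · cases f
      have : x = ![x 0, x 1] := by ext i; fin_cases i <;> rfl
      conv_rhs => rw [this]
      rfl

/-- The complete graph on `n` vertices, as a structure in the language of graphs. -/
def completeGraphStructure (n : ℕ) :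
    CategoryTheory.Bundled.{0} FirstOrder.Language.graph.Structure :=
  ⟨Fin n, (⊤ : SimpleGraph (Fin n)).structure⟩

theorem isIrreducibleHypergraph_completeGraph {n : ℕ} (hn : 2 ≤ n) :
    IsIrreducibleHypergraph (completeGraphStructure n).str := by
  refine ⟨Fin.nontrivial_iff_two_le.2 hn, fun x y hxy => ⟨2, graphRel.adj, ![x, y], hxy, ?_, ?_⟩⟩
  · exact ⟨0, rfl⟩
  · exact ⟨1, rfl⟩

theorem isFreeOf_completeGraph_iff {A : Type u} (G : SimpleGraph A) (n : ℕ) :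
    IsFreeOf {completeGraphStructure n} G.structure ↔ G.CliqueFree n := by
  have key : Nonempty (@FirstOrder.Language.Embedding FirstOrder.Language.graph
      (completeGraphStructure n) A (completeGraphStructure n).str G.structure) ↔
      Nonempty ((⊤ : SimpleGraph (Fin n)) ↪g G) := by
    let _ := (completeGraphStructure n).str
    let _ := G.structure
    constructor
    · rintro ⟨g⟩
      exact ⟨⟨⟨g, g.injective⟩, fun {a b} => g.map_rel graphRel.adj ![a, b]⟩⟩
    · rintro ⟨g⟩
      refine ⟨⟨⟨g, g.injective⟩, fun {n} f => isEmptyElim f, ?_⟩⟩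
      rintro _ ⟨⟩ x
      exact g.map_adj_iff
  have htop : Nonempty ((⊤ : SimpleGraph (Fin n)) ↪g G) ↔ ¬ G.CliqueFree n :=
    ⟨fun ⟨g⟩ => g.isContained.not_cliqueFree,
      fun h => ⟨SimpleGraph.topEmbeddingOfNotCliqueFree h⟩⟩
  rw [← not_iff_not, ← htop, ← key]
  simp [IsFreeOf]

end Graph

section Poset

/-- Antisymmetry is inherited from `r`, which is why the extensible class of posets does not list
it. -/
theorem exists_partialOrder {A : Type u} (S : FirstOrder.Language.order.Structure A)
    (r : LinearOrder A) (hr : ∀ a, leRel S a a)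
    (ht : ∀ a b c, leRel S a b → leRel S b c → leRel S a c) (hle : ∀ a b, leRel S a b → r.le a b) :
    ∃ P : PartialOrder A, posetStructure P = S ∧ Extends r P := by
  let P : PartialOrder A :=
    { le := leRel S
      le_refl := hr
      le_trans := ht
      lt := fun a b => leRel S a b ∧ ¬ leRel S b a
      lt_iff_le_not_ge := fun _ _ => Iff.rfl
      le_antisymm := fun a b hab hba => r.le_antisymm a b (hle _ _ hab) (hle _ _ hba) }
  refine ⟨P, ?_, hle⟩
  ext n f x
  · exact isEmptyElim f
  · cases f
    exact (relMap_iff_leRel S x).symm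

end Poset

end OrderedHomogeneous

/-! ### The five types of structures. -/

theorem mainTheorem2 (κ : Cardinal.{u}) (hκ : ℵ₀ ≤ κ) (A : Type u) (hA : #A = κ)
    (r : LinearOrder A) :
    -- graphs
    (∀ G : SimpleGraph A,
      ∃ (A' : Type u) (G' : SimpleGraph A') (r' : LinearOrder A'), #A' = κ ∧
        IsHomogeneousOrderedExtension G.structure r G'.structure r') ∧
    -- graphs omitting the complete graph on `n` vertices
    (∀ (n : ℕ) (G : SimpleGraph A), G.CliqueFree n →
      ∃ (A' : Type u) (G' : SimpleGraph A') (r' : LinearOrder A'), #A' = κ ∧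
        G'.CliqueFree n ∧
        IsHomogeneousOrderedExtension G.structure r G'.structure r') ∧
    -- hypergraphs in a finite relational signature
    (∀ (L : FirstOrder.Language.{v, v'}) [L.IsRelational] [Finite (Σ l, L.Relations l)]
      (S : L.Structure A), IsHypergraph S →
      ∃ (A' : Type u) (S' : L.Structure A') (r' : LinearOrder A'), #A' = κ ∧
        IsHypergraph S' ∧
        IsHomogeneousOrderedExtension S r S' r') ∧
    -- hypergraphs omitting a class of finite irreducible hypergraphs
    (∀ (L : FirstOrder.Language.{v, v'}) [L.IsRelational] [Finite (Σ l, L.Relations l)]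
      (𝒜 : Set (CategoryTheory.Bundled.{w} L.Structure)),
      (∀ H ∈ 𝒜, Finite H ∧ IsHypergraph H.str ∧ IsIrreducibleHypergraph H.str) →
      ∀ S : L.Structure A, IsHypergraph S → IsFreeOf 𝒜 S →
      ∃ (A' : Type u) (S' : L.Structure A') (r' : LinearOrder A'), #A' = κ ∧
        IsHypergraph S' ∧ IsFreeOf 𝒜 S' ∧
        IsHomogeneousOrderedExtension S r S' r') ∧
    -- posets, with the linear order extending the partial order
    (∀ P : PartialOrder A, Extends r P →
      ∃ (A' : Type u) (P' : PartialOrder A') (r' : LinearOrder A'), #A' = κ ∧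
        Extends r' P' ∧
        IsHomogeneousOrderedExtension (posetStructure P) r (posetStructure P') r') := by

  have hfree : ∀ (L : FirstOrder.Language.{v, v'}) [L.IsRelational]
      (𝒜 : Set (CategoryTheory.Bundled.{w} L.Structure)),
      (∀ H ∈ 𝒜, Finite H ∧ IsIrreducibleHypergraph H.str) →
      ∀ S : L.Structure A, IsHypergraph S → IsFreeOf 𝒜 S →
      ∃ (A' : Type u) (S' : L.Structure A') (r' : LinearOrder A'), #A' = κ ∧
        (IsHypergraph S' ∧ IsFreeOf 𝒜 S') ∧ IsHomogeneousOrderedExtension S r S' r' :=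
    fun L _ 𝒜 h𝒜 S hS hS' =>
      (isExtensible_hypergraph 𝒜 h𝒜).exists_extension hκ A hA S r ⟨hS, hS'⟩
  have hgraph : ∀ (𝒜 : Set (CategoryTheory.Bundled.{0} FirstOrder.Language.graph.Structure)),
      (∀ H ∈ 𝒜, Finite H ∧ IsIrreducibleHypergraph H.str) →
      ∀ G : SimpleGraph A, IsFreeOf 𝒜 G.structure →
      ∃ (A' : Type u) (G' : SimpleGraph A') (r' : LinearOrder A'), #A' = κ ∧
        IsFreeOf 𝒜 G'.structure ∧ IsHomogeneousOrderedExtension G.structure r G'.structure r' := by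
    intro 𝒜 h𝒜 G hG
    obtain ⟨A', S', r', hA', ⟨h1, h2⟩, h3⟩ := (isExtensible_hypergraph 𝒜 h𝒜).exists_extension hκ A
      hA G.structure r ⟨isHypergraph_graph G, hG⟩
    obtain ⟨G', rfl⟩ := exists_graph_of_isHypergraph S' h1
    exact ⟨A', G', r', hA', h2, h3⟩
  refine ⟨fun G => ?_, fun n G hG => ?_, fun L _ _ S hS => ?_, fun L _ _ 𝒜 h𝒜 S hS hS' => ?_,
    fun P hP => ?_⟩
  · obtain ⟨A', G', r', h1, -, h2⟩ := hgraph ∅ (by simp) G (by simp [IsFreeOf])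
    exact ⟨A', G', r', h1, h2⟩
  · have : Infinite A := infinite_iff.2 (hA ▸ hκ)
    -- Complete graphs on fewer than two vertices are not irreducible, but no nonempty graph omits
    -- them.
    have hn : 2 ≤ n := by
      by_contra hn
      have h1 : G.CliqueFree 1 := hG.mono (by omega)
      rw [SimpleGraph.cliqueFree_one] at h1
      exact not_isEmpty_of_nonempty A h1
    obtain ⟨A', G', r', h1, h2, h3⟩ := hgraph {completeGraphStructure n}
      (by
        rintro _ rfl
        exact ⟨inferInstanceAs (Finite (Fin n)), isIrreducibleHypergraph_completeGraph hn⟩)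
      G ((isFreeOf_completeGraph_iff G n).2 hG)
    exact ⟨A', G', r', h1, (isFreeOf_completeGraph_iff G' n).1 h2, h3⟩
  · obtain ⟨A', S', r', h1, h2, h3⟩ := hfree L ∅ (by simp) S hS (by simp [IsFreeOf])
    exact ⟨A', S', r', h1, h2.1, h3⟩
  · obtain ⟨A', S', r', h1, h2, h3⟩ := hfree L 𝒜 (fun H hH => ⟨(h𝒜 H hH).1, (h𝒜 H hH).2.2⟩) S hS hS'
    exact ⟨A', S', r', h1, h2.1, h2.2, h3⟩
  · obtain ⟨A', S', r', h1, ⟨hr, ht, hle⟩, h3⟩ := isExtensible_poset.exists_extension hκ A hA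
      (posetStructure P) r ⟨P.le_refl, P.le_trans, hP⟩
    obtain ⟨P', rfl, hP'⟩ := exists_partialOrder S' r' hr ht hle
    exact ⟨A', P', r', h1, hP', h3⟩
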